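/- Theorem. For $k\in\mathbb N=\{0,1,2,\dots\}$ let $J_k$ denote the Bessel function of the first kind of order $k$, let $\kappa>0$, and for $\alpha>0$ put $$F_k(\alpha)=\frac{\kappa}{\alpha}\,J_k(\alpha)\,J_k'\Bigl(\frac{\kappa}{\alpha}\Bigr)-\alpha\,J_k\Bigl(\frac{\kappa}{\alpha}\Bigr)J_k'(\alpha).$$ Consider on the unit disk $B_1\subset\mathbb R^2$, with polar coordinates $(r,\theta)$, the eigenvalue problem $$\Delta^2u+\kappa^2u=-\lambda\,\Delta u\ \text{ in } B_1,\qquad u=\partial_r u=0\ \text{ on }\partial B_1; \tag{P}$$ an eigenfunction for the eigenvalue $\lambda\in\mathbb R$ is a function $u:\overline{B_1}\to\mathbb C$, smooth up to the boundary and not identically zero, which satisfies (P). Then for all $k\in\mathbb N$ and $\kappa>0$ the set of positive roots of $F_k$ can be written as a strictly increasing sequence $(\alpha_{k,\ell})_{\ell\in\mathbb Z}$ such that $$\alpha_{k,-\ell}=\frac{\kappa}{\alpha_{k,\ell}}\ \ (\ell\in\mathbb Z),\qquad \alpha_{k,0}=\sqrt\kappa,\qquad \alpha_{k,\ell}>\sqrt\kappa>\alpha_{k,-\ell}\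 \ (\ell>0),$$ $$\alpha_{k,\ell}\to+\infty\ \text{ as }\ell\to+\infty,\qquad \alpha_{k,\ell}\to0\ \text{ as }\ell\to-\infty.$$ Moreover, for each $\ell\neq0$ the number $$\lambda_{k,\ell}=\alpha_{k,\ell}^2+\frac{\kappa^2}{\alpha_{k,\ell}^2}=\alpha_{k,\ell}^2+\alpha_{k,-\ell}^2$$ is an eigenvalue of (P). The linear system $$c\,J_k(\alpha_{k,\ell})+d\,J_k\Bigl(\frac{\kappa}{\alpha_{k,\ell}}\Bigr)=0,\qquad c\,\alpha_{k,\ell}\,J_k'(\alpha_{k,\ell})+d\,\frac{\kappa}{\alpha_{k,\ell}}\,J_k'\Bigl(\frac{\kappa}{\alpha_{k,\ell}}\Bigr)=0$$ has a solution $(c,d)\in\mathbb R^2\setminus\{(0,0)\}$, and for every such solution the function $$u(r,\theta)=\bigl(c\,J_k(\alpha_{k,\ell}\,r)+d\,J_k(\alpha_{k,-\ell}\,r)\bigr)e^{ik\theta}$$ is an eigenfunction of (P) for the eigenvalue $\lambda_{k,\ell}$. -/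

import Mathlib

open scoped ContDiff Topology

/-- The Bessel function of the first kind of order `k ∈ ℕ` on the real line, by its power series
`J_k(x) = ∑ₘ (-1)^m / (m! (m+k)!) (x/2)^(2m+k)`. -/
noncomputable def besselJ (k : ℕ) (x : ℝ) : ℝ :=
  ∑' m : ℕ, (-1) ^ m / ((m.factorial : ℝ) * ((m + k).factorial : ℝ)) * (x / 2) ^ (2 * m + k)

/-- The power series defining `J_k` converges for every real argument. -/
theorem summable_besselJ (k : ℕ) (x : ℝ) :
    Summable fun m : ℕ =>
      (-1) ^ m / ((m.factorial : ℝ) * ((m + k).factorial : ℝ)) * (x / 2) ^ (2 * m + k) := by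
  have h := (Real.summable_pow_div_factorial ((x / 2) ^ 2)).mul_left (|x / 2| ^ k)
  refine Summable.of_norm_bounded h ?_
  intro m
  have h1 : (0 : ℝ) < m.factorial := by exact_mod_cast m.factorial_pos
  have h2 : (1 : ℝ) ≤ (m + k).factorial := by exact_mod_cast (m + k).factorial_pos
  have h3 : (1 : ℝ) / ((m.factorial : ℝ) * ((m + k).factorial : ℝ)) ≤ 1 / m.factorial := by
    apply one_div_le_one_div_of_le h1
    nlinarith
  have h4 : ‖(-1 : ℝ) ^ m / ((m.factorial : ℝ) * ((m + k).factorial : ℝ)) * (x / 2) ^ (2 * m + k)‖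
      = 1 / ((m.factorial : ℝ) * ((m + k).factorial : ℝ)) * (|x / 2| ^ (2 * m + k)) := by
    simp [abs_div]
  rw [h4]
  have h5 : |x / 2| ^ (2 * m + k) = |x / 2| ^ k * ((x / 2) ^ 2) ^ m := by
    rw [pow_add, pow_mul, sq_abs, mul_comm]
  rw [h5]
  calc _ ≤ 1 / (m.factorial : ℝ) * (|x / 2| ^ k * ((x / 2) ^ 2) ^ m) :=
        mul_le_mul_of_nonneg_right h3 (by positivity)
    _ = _ := by ring

/-- `F_k(a) = (κ/a) J_k(a) J_k'(κ/a) - a J_k(κ/a) J_k'(a)`. -/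
noncomputable def bucklingF (κ : ℝ) (k : ℕ) (a : ℝ) : ℝ :=
  κ / a * besselJ k a * deriv (besselJ k) (κ / a) - a * besselJ k (κ / a) * deriv (besselJ k) a

/-- The linear system in `(c, d)` expressing `R(1) = 0` and `R'(1) = 0` for
`R(r) = c J_k(a r) + d J_k((κ/a) r)`. -/
def BoundarySystem (κ : ℝ) (k : ℕ) (a c d : ℝ) : Prop :=
  c * besselJ k a + d * besselJ k (κ / a) = 0 ∧
    c * a * deriv (besselJ k) a + d * (κ / a) * deriv (besselJ k) (κ / a) = 0

/-- The function `(r, θ) ↦ R(r) e^{ikθ}` on the plane, which is identified with `ℂ`. -/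
noncomputable def polarMode (k : ℕ) (R : ℝ → ℝ) (z : ℂ) : ℂ :=
  (R ‖z‖ : ℂ) * Complex.exp (Complex.I * k * z.arg)

/-- `u` is an eigenfunction, with eigenvalue `lam`, of the problem `Δ²u + κ² u = -lam Δu` in the
open unit disk, `u = ∂ᵣu = 0` on the unit circle: `u` is smooth up to the boundary, does not vanish
identically on the disk, and satisfies the equation and the boundary conditions pointwise (at a
boundary point the radial derivative is the one-sided one, from inside the disk). Here `Δ` is the
Laplacian of the real plane `ℂ`. -/
def IsBucklingEigenfunction (κ lam : ℝ) (u : ℂ → ℂ) : Prop :=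
  ContDiffOn ℝ ∞ u (Metric.closedBall 0 1) ∧
  (∃ z ∈ Metric.ball (0 : ℂ) 1, u z ≠ 0) ∧
  (∀ z ∈ Metric.ball (0 : ℂ) 1,
    Laplacian.laplacian (Laplacian.laplacian u) z + (κ : ℂ) ^ 2 * u z
      = -((lam : ℂ) * Laplacian.laplacian u z)) ∧
  (∀ z ∈ Metric.sphere (0 : ℂ) 1,
    u z = 0 ∧ HasDerivWithinAt (fun r : ℝ => u (r • z)) 0 (Set.Icc 0 1) 1)

/-- `lam` is an eigenvalue of the buckling problem on the unit disk. -/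
def IsBucklingEigenvalue (κ lam : ℝ) : Prop :=
  ∃ u : ℂ → ℂ, IsBucklingEigenfunction κ lam u

/-! With `G(x) = J_k(x) J_k(κ/x)` one has `G' = -F_k / x`, so the positive roots of `F_k` are the
critical points of `G`. By Sturm comparison `J_k` has arbitrarily large zeros; these are zeros of
`G`, and Rolle gives arbitrarily large roots of `F_k`. Since `F_k` is analytic on `(0, ∞)` and not
identically zero, its roots are locally finite there. Since `F_k(κ/a) = -F_k(a)`, inversion permutes
the roots and fixes `√κ`. Such a set is order isomorphic to `ℤ`, and placing `√κ` at index 0 turns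
inversion into `l ↦ -l`.

For the eigenfunctions, `J_k(ar) e^{ikθ}` satisfies `Δv = -a² v`, and `a²`, `κ²/a²` are the two
roots of `s² - λs + κ²` with `λ = a² + κ²/a²`. The boundary conditions form a linear system with
determinant `F_k(a)`. Smoothness at the origin is handled by writing modes as `z^k ψ(|z|²)` with `ψ`
entire. -/

/-! ### The entire factor of `J_k`: analyticity, derivative, recurrence. -/

/-- The entire function with `J_k(x) = (x/2)^k besselAux k (x^2/4)`. -/
noncomputable def besselAux (k : ℕ) (t : ℝ) : ℝ :=
  ∑' m : ℕ, (-1) ^ m / ((m.factorial : ℝ) * ((m + k).factorial : ℝ)) * t ^ m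

theorem abs_besselAux_coeff_le (k m : ℕ) :
    |(-1 : ℝ) ^ m / ((m.factorial : ℝ) * ((m + k).factorial : ℝ))| ≤ 1 / m.factorial := by
  have h1 : (0 : ℝ) < m.factorial := by exact_mod_cast m.factorial_pos
  have h2 : (1 : ℝ) ≤ (m + k).factorial := by exact_mod_cast (m + k).factorial_pos
  have h3 : |(-1 : ℝ) ^ m / ((m.factorial : ℝ) * ((m + k).factorial : ℝ))|
      = 1 / ((m.factorial : ℝ) * ((m + k).factorial : ℝ)) := by
    simp [abs_div]
  rw [h3]
  exact one_div_le_one_div_of_le h1 (by nlinarith)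

theorem norm_besselAux_term_le (k m : ℕ) (t : ℝ) :
    ‖(-1 : ℝ) ^ m / ((m.factorial : ℝ) * ((m + k).factorial : ℝ)) * t ^ m‖
      ≤ |t| ^ m / m.factorial := by
  rw [norm_mul, norm_pow, Real.norm_eq_abs, Real.norm_eq_abs]
  calc _ ≤ 1 / (m.factorial : ℝ) * |t| ^ m :=
        mul_le_mul_of_nonneg_right (abs_besselAux_coeff_le k m) (by positivity)
    _ = _ := by ring

theorem summable_besselAux (k : ℕ) (t : ℝ) : Summable fun m : ℕ =>
    (-1 : ℝ) ^ m / ((m.factorial : ℝ) * ((m + k).factorial : ℝ)) * t ^ m :=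
  Summable.of_norm_bounded (Real.summable_pow_div_factorial |t|)
    fun m => norm_besselAux_term_le k m t

theorem besselJ_eq_besselAux (k : ℕ) (x : ℝ) :
    besselJ k x = (x / 2) ^ k * besselAux k (x ^ 2 / 4) := by
  unfold besselJ besselAux
  rw [← tsum_mul_left]
  refine tsum_congr fun m => ?_
  rw [show x ^ 2 / 4 = (x / 2) ^ 2 by ring, pow_add, pow_mul]
  ring

theorem analyticOnNhd_besselAux (k : ℕ) : AnalyticOnNhd ℝ (besselAux k) Set.univ := by
  set c : ℕ → ℝ := fun m => (-1) ^ m / ((m.factorial : ℝ) * ((m + k).factorial : ℝ)) with hc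
  have hr : (FormalMultilinearSeries.ofScalars ℝ c).radius = ⊤ := by
    refine FormalMultilinearSeries.radius_eq_top_of_summable_norm _ fun r => ?_
    refine Summable.of_norm_bounded (Real.summable_pow_div_factorial r) fun m => ?_
    rw [FormalMultilinearSeries.ofScalars_norm, norm_mul, norm_norm, norm_pow]
    have := mul_le_mul_of_nonneg_right (abs_besselAux_coeff_le k m)
      (show (0 : ℝ) ≤ (r : ℝ) ^ m by positivity)
    simp only [Real.norm_eq_abs, NNReal.abs_eq, hc]
    calc _ ≤ _ := this
      _ = _ := by ring
  have h := (FormalMultilinearSeries.ofScalars ℝ c).hasFPowerSeriesOnBall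
    (by rw [hr]; exact ENNReal.zero_lt_top)
  have he : (FormalMultilinearSeries.ofScalars ℝ c).sum = besselAux k := by
    ext t
    exact FormalMultilinearSeries.ofScalars_sum_eq c t
  rw [he, hr] at h
  intro x _
  exact h.analyticAt_of_mem (by simp)

theorem contDiff_besselAux (k : ℕ) {n : WithTop ℕ∞} : ContDiff ℝ n (besselAux k) :=
  contDiffOn_univ.1 (analyticOnNhd_besselAux k).contDiffOn_of_completeSpace

theorem hasDerivAt_besselAux (k : ℕ) (t : ℝ) :
    HasDerivAt (besselAux k) (-besselAux (k + 1) t) t := by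
  set g' : ℕ → ℝ → ℝ := fun m y =>
    (-1) ^ m / ((m.factorial : ℝ) * ((m + k).factorial : ℝ)) * (m * y ^ (m - 1)) with hg'
  -- Majorant of the differentiated terms on the ball of radius `|t| + 1`, which contains `t`.
  set u : ℕ → ℝ := fun m => m * (|t| + 1) ^ (m - 1) / m.factorial with hu_def
  have hu : Summable u := by
    rw [← summable_nat_add_iff 1]
    refine (Real.summable_pow_div_factorial (|t| + 1)).congr fun m => ?_
    have := m.factorial_ne_zero
    simp only [hu_def, Nat.factorial_succ, Nat.add_sub_cancel]
    push_cast
    field_simp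
  have key := hasDerivAt_tsum_of_isPreconnected (g' := g') (y₀ := t) (y := t)
    (g := fun m y => (-1 : ℝ) ^ m / ((m.factorial : ℝ) * ((m + k).factorial : ℝ)) * y ^ m)
    (t := Metric.ball 0 (|t| + 1)) hu Metric.isOpen_ball
    (convex_ball (0 : ℝ) (|t| + 1)).isPreconnected
    (fun m y _ => (hasDerivAt_pow m y).const_mul _) (fun m y hy => ?_) (by simp)
    (summable_besselAux k t) (by simp)
  · refine key.congr_deriv ?_
    have hs : Summable fun m => g' m t := by
      refine Summable.of_norm_bounded hu fun m => ?_
      simp only [hg', hu_def]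
      rw [norm_mul, norm_mul, norm_pow, Real.norm_eq_abs, Real.norm_eq_abs, Nat.abs_cast,
        Real.norm_eq_abs]
      calc _ ≤ 1 / (m.factorial : ℝ) * (m * (|t| + 1) ^ (m - 1)) := by
            gcongr
            · exact abs_besselAux_coeff_le k m
            · linarith
        _ = _ := by ring
    rw [hs.tsum_eq_zero_add, besselAux, ← tsum_neg]
    simp only [hg', Nat.cast_zero, zero_mul, mul_zero, zero_add]
    refine tsum_congr fun m => ?_
    have h0 := m.factorial_ne_zero
    have h1 := (m + (k + 1)).factorial_ne_zero
    rw [show m + 1 + k = m + (k + 1) by ring, Nat.factorial_succ m, Nat.add_sub_cancel]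
    push_cast
    field_simp
    ring
  · simp only [hg', hu_def]
    rw [norm_mul, norm_mul, norm_pow, Real.norm_eq_abs, Real.norm_eq_abs, Nat.abs_cast]
    have hy' : ‖y‖ ≤ |t| + 1 := (mem_ball_zero_iff.1 hy).le
    calc _ ≤ 1 / (m.factorial : ℝ) * (m * (|t| + 1) ^ (m - 1)) := by
          gcongr
          exact abs_besselAux_coeff_le k m
      _ = _ := by ring

/-- Coefficient comparison. Together with `hasDerivAt_besselAux` it says `t B'' + (k+1) B' + B = 0`,
the form of Bessel's equation used both for `J_k` and for the Laplacian. -/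
theorem besselAux_recurrence (k : ℕ) (t : ℝ) :
    t * besselAux (k + 2) t - (k + 1) * besselAux (k + 1) t + besselAux k t = 0 := by
  have h0 : besselAux k t = 1 / (k.factorial : ℝ) + ∑' m : ℕ,
      (-1) ^ (m + 1) / (((m + 1).factorial : ℝ) * ((m + 1 + k).factorial : ℝ)) * t ^ (m + 1) := by
    rw [besselAux, (summable_besselAux k t).tsum_eq_zero_add]
    simp
  have h1 : besselAux (k + 1) t = 1 / ((k + 1).factorial : ℝ) + ∑' m : ℕ,
      (-1) ^ (m + 1) / (((m + 1).factorial : ℝ) * ((m + 1 + (k + 1)).factorial : ℝ))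
        * t ^ (m + 1) := by
    rw [besselAux, (summable_besselAux (k + 1) t).tsum_eq_zero_add]
    simp
  have s0 := (summable_nat_add_iff 1).2 (summable_besselAux k t)
  have s1 := (summable_nat_add_iff 1).2 (summable_besselAux (k + 1) t)
  have hk : 1 / (k.factorial : ℝ) = (k + 1) * (1 / ((k + 1).factorial : ℝ)) := by
    have := k.factorial_ne_zero
    rw [Nat.factorial_succ]
    push_cast
    field_simp
  have h : t * besselAux (k + 2) t = (k + 1) * ∑' m : ℕ,
      (-1) ^ (m + 1) / (((m + 1).factorial : ℝ) * ((m + 1 + (k + 1)).factorial : ℝ)) * t ^ (m + 1)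
      - ∑' m : ℕ,
      (-1) ^ (m + 1) / (((m + 1).factorial : ℝ) * ((m + 1 + k).factorial : ℝ)) * t ^ (m + 1) := by
    rw [besselAux, ← tsum_mul_left, ← tsum_mul_left, ← (s1.mul_left _).tsum_sub s0]
    refine tsum_congr fun m => ?_
    have e0 := m.factorial_ne_zero
    have e1 := (m + k + 1).factorial_ne_zero
    rw [show m + (k + 2) = m + k + 1 + 1 by ring, show m + 1 + (k + 1) = m + k + 1 + 1 by ring,
      show m + 1 + k = m + k + 1 by ring, Nat.factorial_succ (m + k + 1), Nat.factorial_succ m]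
    push_cast
    field_simp
    ring
  rw [h, h0, h1, hk]
  ring

/-! ### Bessel functions: analyticity, differential equation, zeros. -/

theorem analyticOnNhd_besselJ (k : ℕ) : AnalyticOnNhd ℝ (besselJ k) Set.univ := by
  have : besselJ k = fun x => (x / 2) ^ k * besselAux k (x ^ 2 / 4) :=
    funext (besselJ_eq_besselAux k)
  rw [this]
  intro x _
  have h : AnalyticAt ℝ (fun x : ℝ => x ^ 2 / 4) x := by fun_prop
  exact ((analyticAt_id.div_const).pow k).mul
    ((analyticOnNhd_besselAux k _ (Set.mem_univ _)).fun_comp h)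

theorem differentiable_besselJ (k : ℕ) : Differentiable ℝ (besselJ k) := fun x =>
  (analyticOnNhd_besselJ k x (Set.mem_univ _)).differentiableAt

/-- The factor `x` avoids the exponent `k - 1`, which truncates at `k = 0`. -/
theorem mul_deriv_besselJ (k : ℕ) (x : ℝ) :
    x * deriv (besselJ k) x
      = k * (x / 2) ^ k * besselAux k (x ^ 2 / 4)
        - 2 * (x / 2) ^ (k + 2) * besselAux (k + 1) (x ^ 2 / 4) := by
  have h2 : HasDerivAt (fun x : ℝ => x ^ 2 / 4) (x / 2) x :=
    ((hasDerivAt_pow 2 x).div_const 4).congr_deriv (by push_cast; ring)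
  have h1 : HasDerivAt (fun x : ℝ => (x / 2) ^ k) (k * (x / 2) ^ (k - 1) * (1 / 2)) x :=
    ((hasDerivAt_id x).div_const 2).pow k
  have h := h1.mul ((hasDerivAt_besselAux k (x ^ 2 / 4)).comp x h2)
  have he : besselJ k = (fun x : ℝ => (x / 2) ^ k) * (besselAux k ∘ fun x => x ^ 2 / 4) :=
    funext (besselJ_eq_besselAux k)
  rw [he, h.deriv]
  simp only [Function.comp]
  cases k with
  | zero => simp; ring
  | succ n => simp only [Nat.add_sub_cancel]; push_cast; ring

/-- Bessel's equation `x (x J_k')' = (k² - x²) J_k`. -/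
theorem hasDerivAt_mul_deriv_besselJ (k : ℕ) {x : ℝ} (hx : x ≠ 0) :
    HasDerivAt (fun x => x * deriv (besselJ k) x) ((k ^ 2 - x ^ 2) / x * besselJ k x) x := by
  have h2 : HasDerivAt (fun x : ℝ => x ^ 2 / 4) (x / 2) x :=
    ((hasDerivAt_pow 2 x).div_const 4).congr_deriv (by push_cast; ring)
  have hp : ∀ n : ℕ, HasDerivAt (fun x : ℝ => (x / 2) ^ n) (n * (x / 2) ^ n / x) x := fun n => by
    refine (((hasDerivAt_id x).div_const 2).pow n).congr_deriv ?_
    cases n with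
    | zero => simp
    | succ n => simp only [Nat.add_sub_cancel, id]; field_simp; ring
  have hA := ((hp k).const_mul (k : ℝ)).mul ((hasDerivAt_besselAux k (x ^ 2 / 4)).comp x h2)
  have hB := ((hp (k + 2)).const_mul (2 : ℝ)).mul
    ((hasDerivAt_besselAux (k + 1) (x ^ 2 / 4)).comp x h2)
  have he : (fun x => x * deriv (besselJ k) x) = fun x =>
      ((fun y => (k : ℝ) * (fun x : ℝ => (x / 2) ^ k) y) * (besselAux k ∘ fun x => x ^ 2 / 4)) x -
      ((fun y => (2 : ℝ) * (fun x : ℝ => (x / 2) ^ (k + 2)) y)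
        * (besselAux (k + 1) ∘ fun x => x ^ 2 / 4)) x := by
    ext y
    exact mul_deriv_besselJ k y
  rw [he]
  refine (hA.sub hB).congr_deriv ?_
  simp only [Function.comp]
  have hr := besselAux_recurrence k (x ^ 2 / 4)
  have hr' : besselAux k (x ^ 2 / 4) = (k + 1) * besselAux (k + 1) (x ^ 2 / 4)
      - x ^ 2 / 4 * besselAux (k + 1 + 1) (x ^ 2 / 4) := by linarith
  rw [besselJ_eq_besselAux, hr']
  push_cast
  rw [pow_add (x / 2) k 2]
  field_simp
  ring

theorem exists_forall_besselJ_pos (k : ℕ) : ∃ δ > 0, ∀ x, 0 < x → x < δ → 0 < besselJ k x := by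
  have h0 : 0 < besselAux k ((0 : ℝ) ^ 2 / 4) := by
    have : besselAux k 0 = 1 / (k.factorial : ℝ) := by
      rw [besselAux, tsum_eq_single 0 (fun m hm => by simp [hm])]
      simp
    norm_num [this]
    positivity
  have hc : Continuous fun x : ℝ => besselAux k (x ^ 2 / 4) :=
    (contDiff_besselAux k (n := 0)).continuous.comp (by fun_prop)
  obtain ⟨δ, hδ, h⟩ := Metric.eventually_nhds_iff.1
    (hc.continuousAt.eventually (lt_mem_nhds h0))
  refine ⟨δ, hδ, fun x hx hxδ => ?_⟩
  rw [besselJ_eq_besselAux]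
  have := h (y := x) (by simpa [abs_of_pos hx] using hxδ)
  positivity

/-- Sturm comparison: `J_k` is of neither strict sign near infinity. -/
theorem exists_gt_mul_besselJ_nonpos (k : ℕ) {σ : ℝ} (M : ℝ) :
    ∃ x > M, σ * besselJ k x ≤ 0 := by
  by_contra! hpos
  obtain ⟨a, ha⟩ : ∃ a : ℝ, max M (k + 1) < Real.exp a :=
    -- `e^a > k + 1` makes `e^{2t} - k² > 1` for `t ≥ a`.
    ⟨_, by rw [Real.exp_log]; exacts [lt_add_one _, by positivity]⟩
  have haM : M < Real.exp a := (le_max_left _ _).trans_lt ha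
  have hak : (k : ℝ) + 1 < Real.exp a := (le_max_right _ _).trans_lt ha
  -- For `y(t) = J_k(e^t)`, Bessel's equation reads `y'' = (k² - e^{2t}) y`. `W` is `σ` times the
  -- Wronskian of `y` with `sin(t - a)`. If `σy > 0` it is monotone on `[a, a + π]`, yet it is
  -- positive at `a` and negative at `a + π`.
  set W : ℝ → ℝ := fun t => σ * (besselJ k (Real.exp t) * Real.cos (t - a)
    - Real.exp t * deriv (besselJ k) (Real.exp t) * Real.sin (t - a)) with hW
  have hd : ∀ t, HasDerivAt W (σ * besselJ k (Real.exp t) * (Real.exp t ^ 2 - k ^ 2 - 1)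
      * Real.sin (t - a)) t := by
    intro t
    have h1 : HasDerivAt (fun t => besselJ k (Real.exp t))
        (deriv (besselJ k) (Real.exp t) * Real.exp t) t :=
      (differentiable_besselJ k _).hasDerivAt.comp t (Real.hasDerivAt_exp t)
    have h2 : HasDerivAt (fun t => Real.exp t * deriv (besselJ k) (Real.exp t))
        ((k ^ 2 - Real.exp t ^ 2) / Real.exp t * besselJ k (Real.exp t) * Real.exp t) t :=
      (hasDerivAt_mul_deriv_besselJ k (Real.exp_ne_zero t)).comp t (Real.hasDerivAt_exp t)
    have hs : HasDerivAt (fun t => t - a) 1 t := (hasDerivAt_id t).sub_const a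
    refine (((h1.mul hs.cos).sub (h2.mul hs.sin)).const_mul σ).congr_deriv ?_
    field_simp
    ring
  have hmono : MonotoneOn W (Set.Icc a (a + Real.pi)) := by
    refine monotoneOn_of_deriv_nonneg (convex_Icc _ _)
      (fun t _ => (hd t).continuousAt.continuousWithinAt)
      (fun t _ => (hd t).differentiableAt.differentiableWithinAt) fun t ht => ?_
    rw [interior_Icc] at ht
    rw [(hd t).deriv]
    have he : Real.exp a < Real.exp t := Real.exp_lt_exp.2 ht.1
    have hs : 0 < Real.sin (t - a) :=
      Real.sin_pos_of_pos_of_lt_pi (by linarith [ht.1]) (by linarith [ht.2])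
    have hJ := hpos _ (haM.trans he)
    have hk : (0 : ℝ) ≤ k := k.cast_nonneg
    have hq : 0 < Real.exp t ^ 2 - k ^ 2 - 1 := by nlinarith
    positivity
  have h := hmono (Set.left_mem_Icc.2 (by linarith [Real.pi_pos]))
    (Set.right_mem_Icc.2 (by linarith [Real.pi_pos])) (by linarith [Real.pi_pos])
  have h1 := hpos _ haM
  have h2 := hpos (Real.exp (a + Real.pi))
    (haM.trans (Real.exp_lt_exp.2 (by linarith [Real.pi_pos])))
  simp [hW] at h
  linarith

theorem exists_gt_besselJ_eq_zero (k : ℕ) (M : ℝ) : ∃ x > M, besselJ k x = 0 := by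
  obtain ⟨x, hx, hx0⟩ := exists_gt_mul_besselJ_nonpos k (σ := 1) M
  obtain ⟨y, hy, hy0⟩ := exists_gt_mul_besselJ_nonpos k (σ := -1) M
  obtain ⟨z, hz, hz0⟩ := (isPreconnected_Ioi (a := M)).intermediate_value hx hy
    (differentiable_besselJ k).continuous.continuousOn
    (show (0 : ℝ) ∈ Set.Icc _ _ from ⟨by linarith, by linarith⟩)
  exact ⟨z, hz, hz0⟩

/-! ### Roots of `bucklingF`. -/

theorem hasDerivAt_besselJ_mul_besselJ_div (k : ℕ) (κ : ℝ) {x : ℝ} (hx : x ≠ 0) :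
    HasDerivAt (fun x => besselJ k x * besselJ k (κ / x)) (-bucklingF κ k x / x) x := by
  have h1 : HasDerivAt (fun x => κ / x) (-κ / x ^ 2) x := by
    simpa [div_eq_mul_inv] using (hasDerivAt_inv hx).const_mul κ
  have h2 : HasDerivAt (fun x => besselJ k (κ / x)) (deriv (besselJ k) (κ / x) * (-κ / x ^ 2)) x :=
    (differentiable_besselJ k _).hasDerivAt.comp x h1
  refine ((differentiable_besselJ k x).hasDerivAt.mul h2).congr_deriv ?_
  unfold bucklingF
  field_simp
  ring

theorem analyticOnNhd_bucklingF (k : ℕ) (κ : ℝ) :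
    AnalyticOnNhd ℝ (bucklingF κ k) (Set.Ioi 0) := by
  intro x hx
  have hJ := fun y => analyticOnNhd_besselJ k y (Set.mem_univ _)
  have hd : AnalyticAt ℝ (fun x : ℝ => κ / x) x :=
    analyticAt_const.div analyticAt_id (ne_of_gt hx)
  exact ((hd.mul (hJ x)).mul ((hJ _).deriv.fun_comp hd)).sub
    ((analyticAt_id.mul ((hJ _).fun_comp hd)).mul (hJ x).deriv)

/-- Otherwise `J_k(x) J_k(κ/x)` is constant, and the constant is 0 because `J_k` has a positive
zero. For large `x` the second factor is positive, so `J_k` vanishes near infinity, hence everywhere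
by analyticity. -/
theorem exists_bucklingF_ne_zero (k : ℕ) {κ : ℝ} (hκ : 0 < κ) :
    ∃ x > 0, bucklingF κ k x ≠ 0 := by
  by_contra! h
  have hconst : ∀ x > 0, ∀ y > 0, besselJ k x * besselJ k (κ / x)
      = besselJ k y * besselJ k (κ / y) := by
    intro x hx y hy
    have hd := fun z (hz : z ∈ Set.Ioi (0 : ℝ)) =>
      hasDerivAt_besselJ_mul_besselJ_div k κ (ne_of_gt hz)
    refine isOpen_Ioi.is_const_of_deriv_eq_zero isPreconnected_Ioi
      (fun z hz => (hd z hz).differentiableAt.differentiableWithinAt) (fun z hz => ?_) hx hy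
    rw [(hd z hz).deriv, h z hz]
    simp
  obtain ⟨δ, hδ, hpos⟩ := exists_forall_besselJ_pos k
  obtain ⟨y, hy, hy0⟩ := exists_gt_besselJ_eq_zero k 0
  have hz : ∀ x > κ / δ, besselJ k x = 0 := by
    intro x hx
    have hx0 : 0 < x := lt_trans (by positivity) hx
    have h1 := hconst x hx0 y hy
    have h2 := hpos (κ / x) (by positivity) (by rwa [div_lt_comm₀ hx0 hδ])
    rw [hy0, zero_mul] at h1
    exact (mul_eq_zero.1 h1).resolve_right h2.ne'
  have hJ := (analyticOnNhd_besselJ k).eqOn_zero_of_preconnected_of_eventuallyEq_zero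
    isPreconnected_univ (Set.mem_univ (κ / δ + 1))
    (Filter.eventually_of_mem (Ioi_mem_nhds (lt_add_one _)) hz)
  exact (hpos (δ / 2) (by positivity) (by linarith)).ne' (hJ (Set.mem_univ _))

/-- Infinitely many roots would accumulate in `[a, b] ⊂ (0, ∞)`, against the identity theorem. -/
theorem finite_bucklingF_zeros_Icc (k : ℕ) {κ : ℝ} (hκ : 0 < κ) {a : ℝ} (b : ℝ) (ha : 0 < a) :
    ({x | 0 < x ∧ bucklingF κ k x = 0} ∩ Set.Icc a b).Finite := by
  by_contra hinf
  obtain ⟨x, hx, hacc⟩ := Set.Infinite.exists_accPt_of_subset_isCompact hinf isCompact_Icc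
    Set.inter_subset_right
  obtain ⟨y, hy, hy0⟩ := exists_bucklingF_ne_zero k hκ
  refine hy0 ((analyticOnNhd_bucklingF k κ).eqOn_zero_of_preconnected_of_frequently_eq_zero
    isPreconnected_Ioi (ha.trans_le hx.1) ?_ hy)
  rw [accPt_iff_frequently_nhdsNE] at hacc
  exact hacc.mono fun z hz => hz.1.2

/-- Rolle for `J_k(x) J_k(κ/x)` between two large zeros of `J_k`. -/
theorem exists_gt_bucklingF_eq_zero (k : ℕ) (κ : ℝ) (M : ℝ) :
    ∃ x > M, 0 < x ∧ bucklingF κ k x = 0 := by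
  obtain ⟨p, hp, hp0⟩ := exists_gt_besselJ_eq_zero k (max M 0)
  obtain ⟨q, hq, hq0⟩ := exists_gt_besselJ_eq_zero k p
  have hp' := max_lt_iff.1 hp
  have hd := fun z (hz : p ≤ z) =>
    hasDerivAt_besselJ_mul_besselJ_div k κ (hp'.2.trans_le hz).ne'
  obtain ⟨x, hx, hx0⟩ := exists_hasDerivAt_eq_zero hq
    (fun z hz => (hd z hz.1).continuousAt.continuousWithinAt) (by simp [hp0, hq0])
    (fun z hz => hd z hz.1.le)
  have hxp : 0 < x := hp'.2.trans hx.1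
  refine ⟨x, hp'.1.trans hx.1, hxp, ?_⟩
  simpa [hxp.ne'] using hx0

theorem bucklingF_div (k : ℕ) {κ : ℝ} (hκ : κ ≠ 0) (a : ℝ) :
    bucklingF κ k (κ / a) = -bucklingF κ k a := by
  unfold bucklingF
  rw [div_div_cancel₀ hκ]
  ring

/-! ### Enumeration of a symmetric set by `ℤ`. -/

theorem OrderIso.eq_refl_of_map_zero (f : ℤ ≃o ℤ) (h0 : f 0 = 0) (n : ℤ) : f n = n := by
  have hs : ∀ n, f (n + 1) = f n + 1 := fun n => by simpa using f.map_succ n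
  induction n using Int.induction_on with
  | zero => exact h0
  | succ i hi => rw [hs, hi]
  | pred i hi =>
    have := hs (-i - 1)
    rw [sub_add_cancel, hi] at this
    linarith

/-- A locally finite set of positive reals which is unbounded, contains `√κ` and is invariant
under `a ↦ κ/a` is enumerated by a bi-infinite increasing sequence with the same symmetry. -/
theorem exists_int_enumeration {κ : ℝ} (hκ : 0 < κ) {Z : Set ℝ} (hpos : ∀ a ∈ Z, 0 < a)
    (hinv : ∀ a ∈ Z, κ / a ∈ Z) (hsqrt : Real.sqrt κ ∈ Z) (hunb : ∀ M, ∃ a ∈ Z, M < a)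
    (hfin : ∀ a b, 0 < a → (Z ∩ Set.Icc a b).Finite) :
    ∃ α : ℤ → ℝ, StrictMono α ∧ Set.range α = Z ∧ (∀ l, α (-l) = κ / α l) ∧
      α 0 = Real.sqrt κ := by
  have hanti : ∀ a ∈ Z, ∀ b ∈ Z, a < b → κ / b < κ / a := fun a ha b _ hab =>
    div_lt_div_of_pos_left hκ (hpos a ha) hab
  have : Nonempty Z := ⟨⟨_, hsqrt⟩⟩
  have : NoMaxOrder Z := ⟨fun a => by
    obtain ⟨b, hb, hab⟩ := hunb a
    exact ⟨⟨b, hb⟩, hab⟩⟩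
  have : NoMinOrder Z := ⟨fun a => by
    obtain ⟨b, hb, hab⟩ := hunb (κ / a)
    refine ⟨⟨κ / b, hinv b hb⟩, Subtype.coe_lt_coe.1 ?_⟩
    rwa [div_lt_comm₀ (hpos a a.2) (hpos b hb)] at hab⟩
  let : LocallyFiniteOrder Z := LocallyFiniteOrder.ofFiniteIcc fun a b => by
    refine Set.Finite.of_finite_image ((hfin a b (hpos a a.2)).subset ?_)
      Subtype.val_injective.injOn
    rintro _ ⟨c, hc, rfl⟩
    exact ⟨c.2, hc⟩
  let : SuccOrder Z := LinearLocallyFiniteOrder.succOrder Z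
  let : PredOrder Z := LinearLocallyFiniteOrder.predOrder Z
  let e : ℤ ≃o Z := (orderIsoIntOfLinearSuccPredArch (ι := Z)).symm
  let s : Z := ⟨_, hsqrt⟩
  -- Shift the indexing so that `√κ` has index 0.
  let e' : ℤ ≃o Z := (OrderIso.addRight (e.symm s)).trans e
  have he0 : e' 0 = s := by simp [e']
  let inv : Z → Z := fun a => ⟨κ / a, hinv a a.2⟩
  have hinvinv : ∀ a, inv (inv a) = a := fun a => Subtype.ext (div_div_cancel₀ hκ.ne')
  have hinv_anti : StrictAnti inv := fun a b hab => hanti a a.2 b b.2 hab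
  -- Negation and inversion both reverse order, so this composite is an order automorphism of `ℤ`;
  -- fixing 0, it is the identity, which is the required symmetry.
  have hmono : StrictMono fun l => e'.symm (inv (e' (-l))) := fun l m hlm =>
    e'.symm.strictMono (hinv_anti (e'.strictMono (neg_lt_neg hlm)))
  have hsurj : Function.Surjective fun l => e'.symm (inv (e' (-l))) := fun m =>
    ⟨-e'.symm (inv (e' m)), by simp [hinvinv]⟩
  let f : ℤ ≃o ℤ := StrictMono.orderIsoOfSurjective _ hmono hsurj
  have hf0 : f 0 = 0 := by
    change e'.symm (inv (e' (-0))) = 0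
    rw [neg_zero, he0, OrderIso.symm_apply_eq, he0]
    exact Subtype.ext (by simp [inv, s])
  refine ⟨fun l => e' l, fun l m hlm => e'.strictMono hlm, ?_, fun l => ?_, ?_⟩
  · ext a
    refine ⟨?_, fun ha => ⟨e'.symm ⟨a, ha⟩, by simp⟩⟩
    rintro ⟨l, rfl⟩
    exact (e' l).2
  · have h : e'.symm (inv (e' (- -l))) = -l := f.eq_refl_of_map_zero hf0 (-l)
    rw [neg_neg, OrderIso.symm_apply_eq] at h
    exact (congrArg Subtype.val h).symm
  · exact congrArg Subtype.val he0

/-! ### Laplacian of `z^k ψ(|z|²)`. -/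

theorem laplacian_eq_of_hasDerivAt {f gx gy : ℂ → ℂ} (hf : ContDiff ℝ 2 f)
    (hx : ∀ z, HasDerivAt (fun t : ℝ => f (z + t * 1)) (gx z) 0)
    (hy : ∀ z, HasDerivAt (fun t : ℝ => f (z + t * Complex.I)) (gy z) 0) {z hxx hyy : ℂ}
    (hxx' : HasDerivAt (fun t : ℝ => gx (z + t * 1)) hxx 0)
    (hyy' : HasDerivAt (fun t : ℝ => gy (z + t * Complex.I)) hyy 0) :
    Laplacian.laplacian f z = hxx + hyy := by
  have hline : ∀ (z v : ℂ), HasDerivAt (fun t : ℝ => z + t * v) v 0 := fun z v => by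
    simpa using ((Complex.ofRealCLM.hasDerivAt (x := (0 : ℝ))).mul_const v).const_add z
  have key : ∀ (v w : ℂ) (g : ℂ → ℂ), (∀ z, HasDerivAt (fun t : ℝ => f (z + t * v)) (g z) 0) →
      HasDerivAt (fun t : ℝ => g (z + t * v)) w 0 → iteratedFDeriv ℝ 2 f z ![v, v] = w := by
    intro v w g h1 h2
    have hg : ∀ z, fderiv ℝ f z v = g z := fun z => by
      have hd : HasFDerivAt f (fderiv ℝ f z) (z + ((0 : ℝ) : ℂ) * v) := by
        simpa using (hf.differentiable (by norm_num) z).hasFDerivAt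
      exact (hd.comp_hasDerivAt (0 : ℝ) (hline z v)).unique (h1 z)
    have hd2 : HasFDerivAt (fderiv ℝ f) (fderiv ℝ (fderiv ℝ f) z) (z + ((0 : ℝ) : ℂ) * v) := by
      simpa using ((hf.fderiv_right (m := 1) (by norm_num)).differentiable
        (by norm_num) z).hasFDerivAt
    have h3 : HasDerivAt (fun t : ℝ => fderiv ℝ f (z + t * v) v)
        (fderiv ℝ (fderiv ℝ f) z v v) 0 :=
      (ContinuousLinearMap.apply ℝ ℂ v).hasFDerivAt.comp_hasDerivAt (0 : ℝ)
        (hd2.comp_hasDerivAt (0 : ℝ) (hline z v))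
    simp only [hg] at h3
    rw [iteratedFDeriv_two_apply]
    exact h3.unique h2
  rw [InnerProductSpace.laplacian_eq_iteratedFDeriv_complexPlane]
  simp only
  rw [key _ _ _ hx hxx', key _ _ _ hy hyy']

theorem contDiff_pow_mul_normSq {ψ : ℝ → ℝ} {n : WithTop ℕ∞} (hψ : ContDiff ℝ n ψ) (k : ℕ) :
    ContDiff ℝ n fun z : ℂ => z ^ k * (ψ (Complex.normSq z) : ℂ) := by
  have h : ContDiff ℝ n fun z : ℂ => Complex.normSq z := by
    simp only [Complex.normSq_apply]
    exact (Complex.reCLM.contDiff.mul Complex.reCLM.contDiff).add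
      (Complex.imCLM.contDiff.mul Complex.imCLM.contDiff)
  exact (contDiff_id.pow k).mul (Complex.ofRealCLM.contDiff.comp (hψ.comp h))

theorem hasDerivAt_line_pow_mul_normSq {ψ ψ₁ : ℝ → ℝ} (h₁ : ∀ t, HasDerivAt ψ (ψ₁ t) t) (k : ℕ)
    (z v : ℂ) :
    HasDerivAt (fun t : ℝ => (z + t * v) ^ k * (ψ (Complex.normSq (z + t * v)) : ℂ))
      (k * z ^ (k - 1) * v * ψ (Complex.normSq z)
        + z ^ k * (ψ₁ (Complex.normSq z) * (2 * (z.re * v.re + z.im * v.im)))) 0 := by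
  have hl : HasDerivAt (fun t : ℝ => z + t * v) v 0 := by
    simpa using ((Complex.ofRealCLM.hasDerivAt (x := (0 : ℝ))).mul_const v).const_add z
  have hn : HasDerivAt (fun t : ℝ => Complex.normSq (z + t * v))
      (2 * (z.re * v.re + z.im * v.im)) 0 := by
    have hr : HasDerivAt (fun t : ℝ => z.re + t * v.re) v.re 0 := by
      simpa using ((hasDerivAt_id (0 : ℝ)).mul_const v.re).const_add z.re
    have hi : HasDerivAt (fun t : ℝ => z.im + t * v.im) v.im 0 := by
      simpa using ((hasDerivAt_id (0 : ℝ)).mul_const v.im).const_add z.im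
    have he : (fun t : ℝ => Complex.normSq (z + t * v)) = fun t =>
        (z.re + t * v.re) * (z.re + t * v.re) + (z.im + t * v.im) * (z.im + t * v.im) := by
      ext t
      simp [Complex.normSq_apply]
    rw [he]
    exact ((hr.fun_mul hr).fun_add (hi.fun_mul hi)).congr_deriv (by ring)
  have h₁' : HasDerivAt ψ (ψ₁ (Complex.normSq z)) (Complex.normSq (z + ((0 : ℝ) : ℂ) * v)) := by
    simpa using h₁ (Complex.normSq z)
  have h := (hl.pow k).mul (h₁'.comp (0 : ℝ) hn).ofReal_comp
  refine h.congr_deriv ?_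
  simp

/-- The Laplacian of `z^k ψ(|z|²)`. -/
theorem laplacian_pow_mul_normSq {ψ ψ₁ ψ₂ : ℝ → ℝ} (hψ : ContDiff ℝ 2 ψ)
    (h₁ : ∀ t, HasDerivAt ψ (ψ₁ t) t) (h₂ : ∀ t, HasDerivAt ψ₁ (ψ₂ t) t) (k : ℕ) (z : ℂ) :
    Laplacian.laplacian (fun z : ℂ => z ^ k * (ψ (Complex.normSq z) : ℂ)) z
      = z ^ k * ((4 * (Complex.normSq z * ψ₂ (Complex.normSq z)
          + (k + 1) * ψ₁ (Complex.normSq z)) : ℝ) : ℂ) := by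
  have hre : ∀ v : ℂ, HasDerivAt (fun t : ℝ => (((z + t * v).re * v.re + (z + t * v).im * v.im : ℝ)
      : ℂ)) ((v.re * v.re + v.im * v.im : ℝ) : ℂ) 0 := fun v => by
    refine HasDerivAt.ofReal_comp ?_
    have hr : HasDerivAt (fun t : ℝ => z.re + t * v.re) v.re 0 := by
      simpa using ((hasDerivAt_id (0 : ℝ)).mul_const v.re).const_add z.re
    have hi : HasDerivAt (fun t : ℝ => z.im + t * v.im) v.im 0 := by
      simpa using ((hasDerivAt_id (0 : ℝ)).mul_const v.im).const_add z.im
    simpa using (hr.mul_const v.re).fun_add (hi.mul_const v.im)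
  have hline := fun v => hasDerivAt_line_pow_mul_normSq h₁ k (v := v)
  have hsecond : ∀ v : ℂ, HasDerivAt (fun t : ℝ =>
      (fun z : ℂ => k * z ^ (k - 1) * v * ψ (Complex.normSq z)
        + z ^ k * (ψ₁ (Complex.normSq z) * (2 * (z.re * v.re + z.im * v.im)))) (z + t * v))
      ((k * v) * ((k - 1 : ℕ) * z ^ (k - 1 - 1) * v * ψ (Complex.normSq z)
        + z ^ (k - 1) * (ψ₁ (Complex.normSq z) * (2 * (z.re * v.re + z.im * v.im))))
       + 2 * ((k * z ^ (k - 1) * v * ψ₁ (Complex.normSq z)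
        + z ^ k * (ψ₂ (Complex.normSq z) * (2 * (z.re * v.re + z.im * v.im))))
          * (z.re * v.re + z.im * v.im)
        + z ^ k * ψ₁ (Complex.normSq z) * (v.re * v.re + v.im * v.im))) 0 := by
    intro v
    -- Each summand of the first derivative is again of the form `z^j φ(|z|²)`, up to factors, so
    -- the first-order formula applies again. Truncation in `k - 1` is harmless: the factor `k`
    -- kills that term at `k = 0`.
    have hA := (hasDerivAt_line_pow_mul_normSq h₁ (k - 1) z v).const_mul (k * v)
    have hB := ((hasDerivAt_line_pow_mul_normSq h₂ k z v).fun_mul (hre v)).const_mul (2 : ℂ)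
    refine ((hA.fun_add hB).congr_deriv ?_).congr_of_eventuallyEq (.of_forall fun t => ?_)
    · simp
    · push_cast
      ring
  rw [laplacian_eq_of_hasDerivAt (contDiff_pow_mul_normSq hψ k) (fun z => hline 1 z)
    (fun z => hline Complex.I z) (hsecond 1) (hsecond Complex.I)]
  have hz : (z : ℂ) = z.re + z.im * Complex.I := (Complex.re_add_im z).symm
  have hI : Complex.I ^ 2 = -1 := Complex.I_sq
  have hN : ((Complex.normSq z : ℝ) : ℂ) = z.re * z.re + z.im * z.im := by
    rw [Complex.normSq_apply]; push_cast; ring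
  have hk : (k : ℂ) * z ^ (k - 1) * (z.re + z.im * Complex.I) = k * z ^ k := by
    rw [← hz]
    cases k with
    | zero => simp
    | succ n => simp only [Nat.add_sub_cancel]; ring
  push_cast
  generalize hp : (ψ (Complex.normSq z) : ℂ) = p
  generalize hp1 : (ψ₁ (Complex.normSq z) : ℂ) = p1
  generalize hp2 : (ψ₂ (Complex.normSq z) : ℂ) = p2
  rw [hN]
  simp only [Complex.one_re, Complex.one_im, Complex.I_re, Complex.I_im, Complex.ofReal_zero,
    Complex.ofReal_one]
  -- `hk` is Euler's identity for `z^k`; `hI` expresses that `z^k` is harmonic.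
  linear_combination (4 * p1) * hk + (k * (k - 1 : ℕ) * z ^ (k - 1 - 1) * p) * hI

/-! ### Eigenfunctions built from Bessel modes. -/

/-- The regular profile of `c J_k(ar) + d J_k(br)`, which is `r^k` times this function of `r²`. -/
noncomputable def besselProfile (k : ℕ) (a b c d : ℝ) (t : ℝ) : ℝ :=
  c * (a / 2) ^ k * besselAux k (a ^ 2 / 4 * t) + d * (b / 2) ^ k * besselAux k (b ^ 2 / 4 * t)

theorem contDiff_besselProfile (k : ℕ) (a b c d : ℝ) {n : WithTop ℕ∞} :
    ContDiff ℝ n (besselProfile k a b c d) := by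
  unfold besselProfile
  exact (contDiff_const.mul ((contDiff_besselAux k).comp (contDiff_const.mul contDiff_id))).add
    (contDiff_const.mul ((contDiff_besselAux k).comp (contDiff_const.mul contDiff_id)))

theorem pow_mul_besselProfile (k : ℕ) (a b c d r : ℝ) :
    r ^ k * besselProfile k a b c d (r ^ 2) = c * besselJ k (a * r) + d * besselJ k (b * r) := by
  rw [besselJ_eq_besselAux, besselJ_eq_besselAux, besselProfile]
  rw [show (a * r) ^ 2 / 4 = a ^ 2 / 4 * r ^ 2 by ring,
    show (b * r) ^ 2 / 4 = b ^ 2 / 4 * r ^ 2 by ring]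
  ring

theorem polarMode_eq_pow_mul_besselProfile (k : ℕ) (a b c d : ℝ) :
    polarMode k (fun r => c * besselJ k (a * r) + d * besselJ k (b * r))
      = fun z => z ^ k * (besselProfile k a b c d (Complex.normSq z) : ℂ) := by
  ext z
  rw [polarMode, ← pow_mul_besselProfile, Complex.normSq_eq_norm_sq]
  have h : z ^ k = (‖z‖ : ℂ) ^ k * Complex.exp (Complex.I * k * z.arg) := by
    conv_lhs => rw [← Complex.norm_mul_exp_arg_mul_I z]
    rw [mul_pow, ← Complex.exp_nat_mul]
    congr 2
    ring
  rw [h]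
  push_cast
  ring

/-- Each Bessel component is an eigenfunction of `Δ`, so `Δ` only rescales `c` and `d`; the
statement can then be iterated for `Δ²`. -/
theorem laplacian_pow_mul_besselProfile (k : ℕ) (a b c d : ℝ) :
    Laplacian.laplacian (fun z : ℂ => z ^ k * (besselProfile k a b c d (Complex.normSq z) : ℂ))
      = fun z => z ^ k * (besselProfile k a b (-a ^ 2 * c) (-b ^ 2 * d) (Complex.normSq z) : ℂ) := by
  have hd : ∀ (j : ℕ) (s t : ℝ), HasDerivAt (fun t => besselAux j (s * t))
      (-besselAux (j + 1) (s * t) * s) t := fun j s t =>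
    (hasDerivAt_besselAux j (s * t)).comp t (by simpa using (hasDerivAt_id t).const_mul s)
  ext z
  rw [laplacian_pow_mul_normSq (contDiff_besselProfile k a b c d)
    (fun t => ((hd k (a ^ 2 / 4) t).const_mul _).add ((hd k (b ^ 2 / 4) t).const_mul _))
    (fun t => (((hd (k + 1) (a ^ 2 / 4) t).neg.mul_const _).const_mul _).add
      (((hd (k + 1) (b ^ 2 / 4) t).neg.mul_const _).const_mul _))]
  congr 2
  have ha := besselAux_recurrence k (a ^ 2 / 4 * Complex.normSq z)
  have hb := besselAux_recurrence k (b ^ 2 / 4 * Complex.normSq z)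
  rw [besselProfile]
  linear_combination (c * (a / 2) ^ k * a ^ 2) * ha + (d * (b / 2) ^ k * b ^ 2) * hb

/-- The determinant of the system is `bucklingF κ k a`. A kernel vector is orthogonal to a nonzero
row; if the first row vanishes, the second is used, or `(1, 0)` when the first column vanishes. -/
theorem exists_boundarySystem_solution {κ : ℝ} {k : ℕ} {a : ℝ} (h : bucklingF κ k a = 0) :
    ∃ c d : ℝ, (c, d) ≠ (0, 0) ∧ BoundarySystem κ k a c d := by
  unfold bucklingF at h
  unfold BoundarySystem
  by_cases h1 : besselJ k a = 0 ∧ besselJ k (κ / a) = 0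
  · by_cases h2 : a * deriv (besselJ k) a = 0
    · exact ⟨1, 0, by simp, by simp [h1.1], by linear_combination h2⟩
    · exact ⟨κ / a * deriv (besselJ k) (κ / a), -(a * deriv (besselJ k) a), by simp [h2],
        by simp [h1.1, h1.2], by ring⟩
  · refine ⟨besselJ k (κ / a), -besselJ k a, fun he => h1 ?_, by ring,
      by linear_combination -h⟩
    simpa [and_comm] using he

/-- The profile vanishes identically on `(0, 1)` only if both coefficients vanish. -/
theorem exists_besselProfile_ne_zero (k : ℕ) {a b c d : ℝ} (ha : 0 < a) (hb : 0 < b)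
    (hab : a ≠ b) (hcd : (c, d) ≠ (0, 0)) :
    ∃ z ∈ Metric.ball (0 : ℂ) 1,
      z ^ k * (besselProfile k a b c d (Complex.normSq z) : ℂ) ≠ 0 := by
  by_contra! h
  -- Applying `Δ` gives a second linear relation, with weights `-a²` and `-b²`. At a radius where
  -- both Bessel values are positive, `a² ≠ b²` forces `c = d = 0`.
  have hlap : ∀ z ∈ Metric.ball (0 : ℂ) 1,
      z ^ k * (besselProfile k a b (-a ^ 2 * c) (-b ^ 2 * d) (Complex.normSq z) : ℂ) = 0 := by
    intro z hz
    rw [← congrFun (laplacian_pow_mul_besselProfile k a b c d) z]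
    have he : (fun z : ℂ => z ^ k * (besselProfile k a b c d (Complex.normSq z) : ℂ))
        =ᶠ[𝓝 z] fun _ => 0 := Filter.eventually_of_mem (Metric.isOpen_ball.mem_nhds hz) h
    rw [(InnerProductSpace.laplacian_congr_nhds he).eq_of_nhds]
    simp
  obtain ⟨δa, hδa, hJa⟩ := exists_forall_besselJ_pos k
  obtain ⟨r, hr0, hr⟩ : ∃ r : ℝ, 0 < r ∧ r < min 1 (min (δa / a) (δa / b)) :=
    exists_between (by positivity)
  simp only [lt_min_iff, lt_div_iff₀ ha, lt_div_iff₀ hb] at hr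
  have hp : ∀ c d : ℝ, (r : ℂ) ^ k * (besselProfile k a b c d (Complex.normSq r) : ℂ) = 0 →
      c * besselJ k (a * r) + d * besselJ k (b * r) = 0 := by
    intro c d h
    rw [← pow_mul_besselProfile, sq, ← Complex.normSq_ofReal]
    exact_mod_cast h
  have hrm : (r : ℂ) ∈ Metric.ball (0 : ℂ) 1 := by simpa [abs_of_pos hr0] using hr.1
  have e1 := hp _ _ (h r hrm)
  have e2 := hp _ _ (hlap r hrm)
  have pa := hJa (a * r) (by positivity) (by linarith [hr.2.1])
  have pb := hJa (b * r) (by positivity) (by linarith [hr.2.2])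
  have hne : a ^ 2 - b ^ 2 ≠ 0 := by
    rw [sq_sub_sq]
    exact mul_ne_zero (by positivity) (sub_ne_zero.2 hab)
  have hc : c = 0 := by
    have : (a ^ 2 - b ^ 2) * besselJ k (a * r) * c = 0 := by linear_combination (-b ^ 2) * e1 - e2
    simpa [hne, pa.ne'] using this
  have hd : d = 0 := by
    rw [hc] at e1
    simpa [pb.ne'] using e1
  exact hcd (by rw [hc, hd])

theorem isBucklingEigenfunction_polarMode {κ : ℝ} (hκ : 0 < κ) {k : ℕ} {a c d : ℝ} (ha : 0 < a)
    (hne : a ≠ κ / a) (hcd : (c, d) ≠ (0, 0)) (h : BoundarySystem κ k a c d) :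
    IsBucklingEigenfunction κ (a ^ 2 + κ ^ 2 / a ^ 2)
      (polarMode k fun r => c * besselJ k (a * r) + d * besselJ k (κ / a * r)) := by
  rw [polarMode_eq_pow_mul_besselProfile]
  refine ⟨(contDiff_pow_mul_normSq (contDiff_besselProfile ..) k).contDiffOn,
    exists_besselProfile_ne_zero k ha (by positivity) hne hcd, fun z _ => ?_, fun z hz => ?_⟩
  · rw [laplacian_pow_mul_besselProfile, laplacian_pow_mul_besselProfile]
    simp only [besselProfile]
    have : (a : ℂ) ≠ 0 := by exact_mod_cast ha.ne'
    push_cast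
    field_simp
    ring
  · have hz1 : ‖z‖ = 1 := by simpa using hz
    -- Valid for every real `r`, so the radial derivative at 1 may be taken two-sided.
    have hray : ∀ r : ℝ, (r • z) ^ k * (besselProfile k a (κ / a) c d (Complex.normSq (r • z)) : ℂ)
        = z ^ k * ((c * besselJ k (a * r) + d * besselJ k (κ / a * r) : ℝ) : ℂ) := by
      intro r
      rw [← pow_mul_besselProfile, Complex.real_smul, map_mul, Complex.normSq_ofReal,
        Complex.normSq_eq_norm_sq z, hz1]
      push_cast
      ring_nf
    constructor
    · have := hray 1
      rw [one_smul, mul_one, mul_one, h.1] at this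
      simpa using this
    · refine HasDerivAt.hasDerivWithinAt ?_
      simp only [hray]
      have hJ : ∀ a : ℝ, HasDerivAt (fun r => besselJ k (a * r)) (deriv (besselJ k) a * a) 1 := by
        intro a
        have h1 : HasDerivAt (besselJ k) (deriv (besselJ k) a) (a * 1) := by
          simpa using (differentiable_besselJ k a).hasDerivAt
        exact h1.comp (1 : ℝ) (by simpa using (hasDerivAt_id (1 : ℝ)).const_mul a)
      refine ((((hJ a).const_mul c).add ((hJ (κ / a)).const_mul d)).ofReal_comp.const_mul
        (z ^ k)).congr_deriv ?_
      rw [show c * (deriv (besselJ k) a * a) + d * (deriv (besselJ k) (κ / a) * (κ / a)) = 0 by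
        linear_combination h.2]
      simp

/-! ### Assembly. -/

theorem mainTheorem6 (k : ℕ) (κ : ℝ) (hκ : 0 < κ) :
    ∃ α : ℤ → ℝ,
      StrictMono α ∧
      Set.range α = {a : ℝ | 0 < a ∧ bucklingF κ k a = 0} ∧
      (∀ l : ℤ, α (-l) = κ / α l) ∧
      α 0 = Real.sqrt κ ∧
      (∀ l : ℤ, 0 < l → Real.sqrt κ < α l ∧ α (-l) < Real.sqrt κ) ∧
      Filter.Tendsto α Filter.atTop Filter.atTop ∧
      Filter.Tendsto α Filter.atBot (𝓝 0) ∧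
      ∀ l : ℤ, l ≠ 0 →
        (α l) ^ 2 + κ ^ 2 / (α l) ^ 2 = (α l) ^ 2 + (α (-l)) ^ 2 ∧
        IsBucklingEigenvalue κ ((α l) ^ 2 + κ ^ 2 / (α l) ^ 2) ∧
        (∃ c d : ℝ, (c, d) ≠ (0, 0) ∧ BoundarySystem κ k (α l) c d) ∧
        (∀ c d : ℝ, (c, d) ≠ (0, 0) → BoundarySystem κ k (α l) c d →
          IsBucklingEigenfunction κ ((α l) ^ 2 + κ ^ 2 / (α l) ^ 2)
            (polarMode k fun r => c * besselJ k (α l * r) + d * besselJ k (α (-l) * r))) := by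
  have hs : 0 < Real.sqrt κ := Real.sqrt_pos.2 hκ
  have hκs : κ / Real.sqrt κ = Real.sqrt κ := Real.div_sqrt
  obtain ⟨α, hα, hrange, hinv, h0⟩ := exists_int_enumeration hκ
    (Z := {a : ℝ | 0 < a ∧ bucklingF κ k a = 0}) (fun a ha => ha.1)
    (fun a ha => ⟨div_pos hκ ha.1, by rw [bucklingF_div k hκ.ne', ha.2, neg_zero]⟩)
    ⟨hs, by rw [bucklingF, hκs]; ring⟩
    (fun M => by
      obtain ⟨x, hxM, hx⟩ := exists_gt_bucklingF_eq_zero k κ M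
      exact ⟨x, hx, hxM⟩)
    (fun a b ha => finite_bucklingF_zeros_Icc k hκ b ha)
  have hmem : ∀ l, 0 < α l ∧ bucklingF κ k (α l) = 0 := fun l =>
    hrange.subset (Set.mem_range_self l)
  have htop : Filter.Tendsto α Filter.atTop Filter.atTop :=
    Filter.tendsto_atTop_atTop_of_monotone hα.monotone fun M => by
      obtain ⟨x, hxM, hx⟩ := exists_gt_bucklingF_eq_zero k κ M
      obtain ⟨l, rfl⟩ := hrange.superset hx
      exact ⟨l, hxM.le⟩
  refine ⟨α, hα, hrange, hinv, h0, fun l hl => ?_, htop, ?_, fun l hl => ?_⟩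
  · rw [← h0]
    exact ⟨hα hl, hα (neg_lt_zero.2 hl)⟩
  -- Near `-∞` the sequence is `κ / α(-l)` with `α(-l) → ∞`.
  · have h := (htop.comp Filter.tendsto_neg_atBot_atTop).const_div_atTop κ
    refine h.congr fun l => ?_
    rw [Function.comp, hinv, div_div_cancel₀ hκ.ne']
  -- This uses `l ≠ 0`: at `l = 0` the two radial functions coincide and their combination could
  -- vanish.
  · have hne : α l ≠ κ / α l := by
      rw [← hinv]
      exact hα.injective.ne (by omega)
    have heig : ∀ c d : ℝ, (c, d) ≠ (0, 0) → BoundarySystem κ k (α l) c d →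
        IsBucklingEigenfunction κ ((α l) ^ 2 + κ ^ 2 / (α l) ^ 2)
          (polarMode k fun r => c * besselJ k (α l * r) + d * besselJ k (α (-l) * r)) := by
      intro c d hcd h
      rw [hinv]
      exact isBucklingEigenfunction_polarMode hκ (hmem l).1 hne hcd h
    obtain ⟨c, d, hcd, h⟩ := exists_boundarySystem_solution (hmem l).2
    exact ⟨by rw [hinv, div_pow], ⟨_, heig c d hcd h⟩, ⟨c, d, hcd, h⟩, heig⟩
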